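/- Let $\mathbb F\in\{\mathbb R,\mathbb C\}$ and let $K$ be a Tychonoff space which is selectively sequentially pseudocompact, that is: for every sequence $(U_n)_{n\in\omega}$ of nonempty open subsets of $K$ there exist points $x_n\in U_n$ such that the sequence $(x_n)_{n\in\omega}$ has a subsequence converging in $K$. Let $C_p(K)$ be the space of all continuous functions $K\to\mathbb F$ with the topology of pointwise convergence, and let $C(K)$ be the Banach space of all continuous functions $K\to\mathbb F$ (which are all bounded, since $K$ is pseudocompact) with the supremum norm. Then the locally convex spaces $C_p(K)$ and $C(K)$ are Gelfand–Phillips. Here a barrel in a locally convex space $E$ over $\mathbb F$ is a closed absolutely convex absorbing subset of $E$. A subset $A\subseteq E$ is barrel-bounded if for every barrel $B\subseteq E$ there is $n\in\omega$ with $A\subseteq nB$; barrel-precompact if for every barrel $B\subseteq E$ there is a finite set $F\subseteq E$ with $A\subseteq F+B$; and limited if it is barrel-bounded and every weak$^*$ null sequence $(\chi_n)_{n\in\omega}$ in the topological dual $E'$ converges to $0$ uniformly on $A$. The space $E$ is Gelfand–Phillips if every limited subset of $E$ is barrel-precompact. -/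

import Mathlib

open Set Filter Topology
open scoped BoundedContinuousFunction Pointwise

/-- `X` is selectively sequentially pseudocompact at `A`: for any open sets `U n` meeting `A` there
are points `x n ∈ U n` such that some subsequence of `x` converges in `X`. -/
def SelectivelySeqPseudocompactAt (X : Type*) [TopologicalSpace X] (A : Set X) : Prop :=
  ∀ U : ℕ → Set X, (∀ n, IsOpen (U n)) → (∀ n, (U n ∩ A).Nonempty) →
    ∃ x : ℕ → X, (∀ n, x n ∈ U n) ∧
      ∃ φ : ℕ → ℕ, StrictMono φ ∧ ∃ l : X, Tendsto (x ∘ φ) atTop (𝓝 l)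

/-- `X` is selectively sequentially pseudocompact (at itself). -/
def SelectivelySeqPseudocompactSpace (X : Type*) [TopologicalSpace X] : Prop :=
  SelectivelySeqPseudocompactAt X (univ : Set X)

section GelfandPhillips

/-- A barrel: a closed, absolutely convex, absorbing subset. -/
structure IsBarrel (𝕜 : Type*) [RCLike 𝕜] {E : Type*} [AddCommGroup E] [Module 𝕜 E] [Module ℝ E]
    [TopologicalSpace E] (B : Set E) : Prop where
  isClosed : IsClosed B
  convex : Convex ℝ B
  balanced : Balanced 𝕜 B
  absorbent : Absorbent 𝕜 B

/-- `A` is barrel-bounded, i.e. bounded for the topology `β(E, E')` on `E` whose neighbourhood base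
at zero consists of the barrels. -/
def IsBarrelBounded (𝕜 : Type*) [RCLike 𝕜] {E : Type*} [AddCommGroup E] [Module 𝕜 E] [Module ℝ E]
    [TopologicalSpace E] (A : Set E) : Prop :=
  ∀ B : Set E, IsBarrel 𝕜 B → ∃ n : ℕ, A ⊆ (n : 𝕜) • B

/-- `A` is barrel-precompact, i.e. precompact for the topology `β(E, E')` on `E` whose neighbourhood
base at zero consists of the barrels. -/
def IsBarrelPrecompact (𝕜 : Type*) [RCLike 𝕜] {E : Type*} [AddCommGroup E] [Module 𝕜 E]
    [Module ℝ E] [TopologicalSpace E] (A : Set E) : Prop :=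
  ∀ B : Set E, IsBarrel 𝕜 B → ∃ F : Set E, F.Finite ∧ A ⊆ F + B

/-- `A` is limited: it is barrel-bounded and every weak-star null sequence in `E'` converges to
zero uniformly on `A`. -/
def IsLimited (𝕜 : Type*) [RCLike 𝕜] {E : Type*} [AddCommGroup E] [Module 𝕜 E] [Module ℝ E]
    [TopologicalSpace E] (A : Set E) : Prop :=
  IsBarrelBounded 𝕜 A ∧
    ∀ χ : ℕ → WeakDual 𝕜 E, Tendsto χ atTop (𝓝 0) →
      TendstoUniformlyOn (fun n x => χ n x) (fun _ => (0 : 𝕜)) atTop A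

/-- A (Hausdorff) locally convex space is Gelfand–Phillips if all its limited subsets are
barrel-precompact. -/
def IsGelfandPhillips (𝕜 : Type*) [RCLike 𝕜] (E : Type*) [AddCommGroup E] [Module 𝕜 E]
    [Module ℝ E] [IsScalarTower ℝ 𝕜 E] [TopologicalSpace E] [IsTopologicalAddGroup E]
    [ContinuousSMul 𝕜 E] [LocallyConvexSpace ℝ E] [T2Space E] : Prop :=
  ∀ A : Set E, IsLimited 𝕜 A → IsBarrelPrecompact 𝕜 A

end GelfandPhillips

noncomputable section FunctionSpaces

/-- The set of all continuous `𝕜`-valued functions on `X`; below it is given the topology of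
pointwise convergence. This is the space `C_p(X)`. -/
def Cp (X 𝕜 : Type*) [TopologicalSpace X] [RCLike 𝕜] : Type _ := C(X, 𝕜)

namespace Cp

instance (X 𝕜 : Type*) [TopologicalSpace X] [RCLike 𝕜] : FunLike (Cp X 𝕜) X 𝕜 :=
  inferInstanceAs (FunLike C(X, 𝕜) X 𝕜)

instance (X 𝕜 : Type*) [TopologicalSpace X] [RCLike 𝕜] : AddCommGroup (Cp X 𝕜) :=
  inferInstanceAs (AddCommGroup C(X, 𝕜))

instance (X 𝕜 : Type*) [TopologicalSpace X] [RCLike 𝕜] : Module 𝕜 (Cp X 𝕜) :=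
  inferInstanceAs (Module 𝕜 C(X, 𝕜))

instance (X 𝕜 : Type*) [TopologicalSpace X] [RCLike 𝕜] : Module ℝ (Cp X 𝕜) :=
  inferInstanceAs (Module ℝ C(X, 𝕜))

instance (X 𝕜 : Type*) [TopologicalSpace X] [RCLike 𝕜] : IsScalarTower ℝ 𝕜 (Cp X 𝕜) :=
  inferInstanceAs (IsScalarTower ℝ 𝕜 C(X, 𝕜))

/-- The topology of pointwise convergence. -/
instance (X 𝕜 : Type*) [TopologicalSpace X] [RCLike 𝕜] : TopologicalSpace (Cp X 𝕜) :=
  TopologicalSpace.induced (fun (f : Cp X 𝕜) (x : X) => f x) inferInstance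

/-- The inclusion of `C_p(X)` into the product `𝕜 ^ X`, as a `𝕜`-linear map. -/
def coeLin (X 𝕜 : Type*) [TopologicalSpace X] [RCLike 𝕜] : Cp X 𝕜 →ₗ[𝕜] (X → 𝕜) where
  toFun f x := f x
  map_add' _ _ := rfl
  map_smul' _ _ := rfl

/-- The inclusion of `C_p(X)` into the product `𝕜 ^ X`, as a real-linear map. -/
def coeLinReal (X 𝕜 : Type*) [TopologicalSpace X] [RCLike 𝕜] : Cp X 𝕜 →ₗ[ℝ] (X → 𝕜) where
  toFun f x := f x
  map_add' _ _ := rfl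
  map_smul' _ _ := rfl

instance (X 𝕜 : Type*) [TopologicalSpace X] [RCLike 𝕜] : IsTopologicalAddGroup (Cp X 𝕜) :=
  topologicalAddGroup_induced (coeLin X 𝕜)

instance (X 𝕜 : Type*) [TopologicalSpace X] [RCLike 𝕜] : ContinuousSMul 𝕜 (Cp X 𝕜) :=
  continuousSMul_induced (coeLin X 𝕜)

instance (X 𝕜 : Type*) [TopologicalSpace X] [RCLike 𝕜] : LocallyConvexSpace ℝ (Cp X 𝕜) :=
  LocallyConvexSpace.induced (coeLinReal X 𝕜)

instance (X 𝕜 : Type*) [TopologicalSpace X] [RCLike 𝕜] : T2Space (Cp X 𝕜) :=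
  T2Space.of_injective_continuous (f := fun (f : Cp X 𝕜) (x : X) => f x)
    DFunLike.coe_injective continuous_induced_dom

end Cp

/-- On a selectively sequentially pseudocompact space every continuous function is bounded. Hence
the set `C(K)` of all continuous functions on such a space `K`, with the supremum norm, is Mathlib's
Banach space `K →ᵇ 𝕜` of bounded continuous functions. -/
theorem SelectivelySeqPseudocompactSpace.exists_norm_le {K : Type*} [TopologicalSpace K]
    (hK : SelectivelySeqPseudocompactSpace K) {𝕜 : Type*} [RCLike 𝕜] (f : C(K, 𝕜)) :
    ∃ C : ℝ, ∀ x, ‖f x‖ ≤ C := by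
  by_contra! h
  obtain ⟨x, hx, φ, hφ, l, hl⟩ := hK (fun n => {x | (n : ℝ) < ‖f x‖})
    (fun n => isOpen_lt continuous_const f.continuous.norm)
    (fun n => by obtain ⟨y, hy⟩ := h n; exact ⟨y, hy, mem_univ y⟩)
  have h1 : Tendsto (fun n => ‖f (x (φ n))‖) atTop (𝓝 ‖f l‖) :=
    (f.continuous.norm.tendsto l).comp hl
  have h2 : Tendsto (fun n => ‖f (x (φ n))‖) atTop atTop :=
    tendsto_atTop_mono (fun n => (hx (φ n)).le)
      (tendsto_natCast_atTop_atTop.comp hφ.tendsto_atTop)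
  exact not_tendsto_nhds_of_tendsto_atTop h2 _ h1

/-- The linear identification of the set of all continuous functions on a selectively sequentially
pseudocompact space with the Banach space of bounded continuous functions. -/
def SelectivelySeqPseudocompactSpace.equivBounded {K : Type*} [TopologicalSpace K]
    (hK : SelectivelySeqPseudocompactSpace K) (𝕜 : Type*) [RCLike 𝕜] :
    C(K, 𝕜) ≃ₗ[𝕜] (K →ᵇ 𝕜) where
  toFun f := BoundedContinuousFunction.ofNormedAddCommGroup f f.continuous
    (hK.exists_norm_le f).choose (hK.exists_norm_le f).choose_spec
  map_add' _ _ := rfl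
  map_smul' _ _ := rfl
  invFun g := g.toContinuousMap
  left_inv _ := rfl
  right_inv _ := rfl

end FunctionSpaces

/-!
A limited set `A` of continuous functions on `K` is precompact for the supremum norm, and this
suffices because every barrel, of `C_p(K)` as of `C(K)`, contains a ball of the supremum norm: its
trace on the Banach space `C(K)` is a barrel there, hence a neighbourhood of zero by Baire
(`IsBarrel.mem_nhds_zero`).

To see that `A` is precompact, consider on `K` the pseudometric `d x y = sup_{f ∈ A} |f x - f y|`.
If `x n → l` in `K`, the differences of evaluations `δ_{x n} - δ_l` are weak-star null, so
`d (x n) l → 0` because `A` is limited. The heart of the proof is that then `K` is totally bounded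
for `d` (`SelectivelySeqPseudocompactSpace.finitelyApproximable_univ`). Otherwise a nonempty open
subset `W` of `K` can be separated, by a single `f ∈ A` and by a fixed distance, from an open set
which is still not totally bounded at the given scale
(`exists_separated_of_not_finitelyApproximable`). Iterating inside the latter set produces nonempty
open sets `U n` at pairwise `d`-distance bounded below, so no sequence of points `x n ∈ U n` has a
subsequence that is Cauchy for `d`, against selective sequential pseudocompactness.

Finally, total boundedness of `K` for `d` passes to `A` for the supremum norm: up to a small error a
function in `A` is determined by its values on a finite `d`-net, and `A` is pointwise bounded since
it is barrel-bounded.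
-/

/-- The set `V` is covered by finitely many closed balls of radius `ε` for the pseudometric
`sup_i dist (F i x) (F i y)` of the family `F`. The supremum is spelled out as a bound for
all `i`, so that no boundedness is presupposed. -/
def FinitelyApproximable {ι K M : Type*} [PseudoMetricSpace M] (F : ι → K → M) (ε : ℝ)
    (V : Set K) : Prop :=
  ∃ s : Set K, s.Finite ∧ ∀ x ∈ V, ∃ y ∈ s, ∀ i, dist (F i x) (F i y) ≤ ε

/-- An open set that is not coverable by finitely many `ε`-balls contains a nonempty open set and an
open set, again not so coverable, that some `F i` maps to sets at distance at least `ε / 4`. -/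
theorem exists_separated_of_not_finitelyApproximable {ι K M : Type*} [TopologicalSpace K]
    [PseudoMetricSpace M] {F : ι → K → M} (hF : ∀ i, Continuous (F i))
    (hFb : ∀ i, TotallyBounded (range (F i))) {ε : ℝ} (hε : 0 < ε) {V : Set K} (hVo : IsOpen V)
    (hV : ¬ FinitelyApproximable F ε V) :
    ∃ W V' : Set K, IsOpen W ∧ W.Nonempty ∧ W ⊆ V ∧ IsOpen V' ∧ V' ⊆ V ∧
      ¬ FinitelyApproximable F ε V' ∧
      ∃ i, ∀ w ∈ W, ∀ v ∈ V', ε / 4 ≤ dist (F i w) (F i v) := by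
  obtain ⟨x₀, hx₀⟩ : V.Nonempty := by
    by_contra h
    rw [not_nonempty_iff_eq_empty] at h
    exact hV ⟨∅, finite_empty, by simp [h]⟩
  obtain ⟨x, hx, i, hi⟩ : ∃ x ∈ V, ∃ i, ε < dist (F i x) (F i x₀) := by
    by_contra! h
    exact hV ⟨{x₀}, finite_singleton _, fun x hx => ⟨x₀, rfl, h x hx⟩⟩
  obtain ⟨t, ht, hcov⟩ := Metric.totallyBounded_iff.1 (hFb i) (ε / 8) (by positivity)
  obtain ⟨c, hc⟩ : ∃ c, ¬ FinitelyApproximable F ε (V ∩ F i ⁻¹' Metric.ball c (ε / 8)) := by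
    by_contra! h
    choose s hs hsV using h
    refine hV ⟨⋃ c ∈ t, s c, ht.biUnion fun c _ => hs c, fun y hy => ?_⟩
    obtain ⟨c, hct, hyc⟩ := mem_iUnion₂.1 (hcov (mem_range_self y))
    obtain ⟨z, hz, hyz⟩ := hsV c y ⟨hy, hyc⟩
    exact ⟨z, mem_iUnion₂.2 ⟨c, hct, hz⟩, hyz⟩
  -- As `F i x` and `F i x₀` are far apart, one of them is far from the centre `c`.
  obtain ⟨z, hz, hzc⟩ : ∃ z ∈ V, ε / 2 ≤ dist (F i z) c := by
    by_contra! h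
    linarith [h x hx, h x₀ hx₀, dist_triangle_right (F i x) (F i x₀) c]
  refine ⟨V ∩ F i ⁻¹' Metric.ball (F i z) (ε / 8), V ∩ F i ⁻¹' Metric.ball c (ε / 8),
    hVo.inter (Metric.isOpen_ball.preimage (hF i)), ⟨z, hz, Metric.mem_ball_self (by positivity)⟩,
    inter_subset_left, hVo.inter (Metric.isOpen_ball.preimage (hF i)), inter_subset_left, hc, i, ?_⟩
  rintro w ⟨-, hw⟩ v ⟨-, hv⟩
  rw [mem_preimage, Metric.mem_ball] at hw hv
  rw [dist_comm] at hw
  linarith [dist_triangle4 (F i z) (F i w) (F i v) c]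

/-- If `F i (x n) → F i l` uniformly in `i` whenever `x n → l`, then a selectively sequentially
pseudocompact space is totally bounded for the pseudometric `sup_i dist (F i x) (F i y)`. -/
theorem SelectivelySeqPseudocompactSpace.finitelyApproximable_univ {ι K M : Type*}
    [TopologicalSpace K] (hK : SelectivelySeqPseudocompactSpace K) [PseudoMetricSpace M]
    {F : ι → K → M} (hF : ∀ i, Continuous (F i)) (hFb : ∀ i, TotallyBounded (range (F i)))
    (hseq : ∀ (x : ℕ → K) (l : K), Tendsto x atTop (𝓝 l) →
      TendstoUniformly (fun n i => F i (x n)) (fun i => F i l) atTop)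
    {ε : ℝ} (hε : 0 < ε) : FinitelyApproximable F ε univ := by
  by_contra hbad
  have step : ∀ V : {V : Set K // IsOpen V ∧ ¬ FinitelyApproximable F ε V},
      ∃ (W : Set K) (V' : {V : Set K // IsOpen V ∧ ¬ FinitelyApproximable F ε V}),
        IsOpen W ∧ W.Nonempty ∧ W ⊆ V.1 ∧ V'.1 ⊆ V.1 ∧
        ∃ i, ∀ w ∈ W, ∀ v ∈ V'.1, ε / 4 ≤ dist (F i w) (F i v) := by
    rintro ⟨V, hVo, hV⟩
    obtain ⟨W, V', hWo, hW, hWV, hVo', hVV', hV', hsep⟩ :=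
      exists_separated_of_not_finitelyApproximable hF hFb hε hVo hV
    exact ⟨W, ⟨V', hVo', hV'⟩, hWo, hW, hWV, hVV', hsep⟩
  choose W next hWo hW hWV hnext i hi using step
  let V : ℕ → {V : Set K // IsOpen V ∧ ¬ FinitelyApproximable F ε V} :=
    fun n => n.rec ⟨univ, isOpen_univ, hbad⟩ fun _ V => next V
  have hanti : Antitone fun n => (V n).1 := antitone_nat_of_succ_le fun n => hnext (V n)
  obtain ⟨x, hx, φ, hφ, l, hl⟩ := hK (fun n => W (V n)) (fun n => hWo _)
    (fun n => by simpa using hW (V n))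
  obtain ⟨N, hN⟩ := eventually_atTop.1
    (Metric.tendstoUniformly_iff.1 (hseq _ l hl) (ε / 8) (by positivity))
  have hlt : φ N + 1 ≤ φ (N + 1) := hφ N.lt_succ_self
  have h1 := hi (V (φ N)) _ (hx (φ N)) _ (hanti hlt (hWV _ (hx (φ (N + 1)))))
  have h2 := hN N le_rfl (i (V (φ N)))
  have h3 := hN (N + 1) N.le_succ (i (V (φ N)))
  simp only [Function.comp_apply] at h2 h3
  linarith [dist_triangle_left (F (i (V (φ N))) (x (φ N))) (F (i (V (φ N))) (x (φ (N + 1))))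
    (F (i (V (φ N))) l)]

/-- If `K` is totally bounded for the pseudometric of a pointwise bounded family `F`, then `F` is
totally bounded for uniform convergence. -/
theorem exists_finite_forall_dist_le {ι K M : Type*} [PseudoMetricSpace M] [ProperSpace M]
    {F : ι → K → M} (hb : ∀ x, Bornology.IsBounded (range fun i => F i x))
    (hF : ∀ ε > 0, FinitelyApproximable F ε univ) {ε : ℝ} (hε : 0 < ε) :
    ∃ t : Set ι, t.Finite ∧ ∀ i, ∃ j ∈ t, ∀ x, dist (F i x) (F j x) ≤ ε := by
  obtain ⟨s, hs, hsK⟩ := hF (ε / 3) (by positivity)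
  have := hs.fintype
  have hbdd : TotallyBounded (range fun (i : ι) (y : s) => F i y) := by
    refine TotallyBounded.subset subset_closure (Bornology.IsBounded.isCompact_closure
      (Bornology.forall_isBounded_image_eval_iff.1 fun y => ?_)).totallyBounded
    rw [← range_comp]
    exact hb y
  obtain ⟨c, hcs, hc, hcov⟩ := Metric.finite_approx_of_totallyBounded hbdd (ε / 3) (by positivity)
  obtain ⟨t, rfl⟩ := subset_range_iff_exists_image_eq.1 hcs
  obtain ⟨t', -, ht'⟩ := exists_subset_bijOn t fun (i : ι) (y : s) => F i y
  refine ⟨t', ht'.finite_iff_finite.2 hc, fun i => ?_⟩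
  obtain ⟨_, hjt, hij⟩ := mem_iUnion₂.1 (hcov (mem_range_self i))
  obtain ⟨j, hj, rfl⟩ := ht'.surjOn hjt
  refine ⟨j, hj, fun x => ?_⟩
  obtain ⟨y, hy, hxy⟩ := hsK x (mem_univ x)
  have hy' : dist (F i y) (F j y) < ε / 3 := (dist_le_pi_dist _ _ (⟨y, hy⟩ : s)).trans_lt hij
  have hj' := hxy j
  rw [dist_comm] at hj'
  linarith [dist_triangle4 (F i x) (F i y) (F j y) (F j x), hxy i]

/-- A barrel of a Banach space is a neighbourhood of zero. -/
theorem IsBarrel.mem_nhds_zero {𝕜 : Type*} [RCLike 𝕜] {E : Type*} [NormedAddCommGroup E]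
    [NormedSpace 𝕜 E] [NormedSpace ℝ E] [CompleteSpace E] {B : Set E} (hB : IsBarrel 𝕜 B) :
    B ∈ 𝓝 (0 : E) := by
  have hne : ∀ n : ℕ, ((n + 1 : ℕ) : 𝕜) ≠ 0 := fun n => Nat.cast_ne_zero.2 n.succ_ne_zero
  have hlim : Tendsto (fun n : ℕ => ((n + 1 : ℕ) : 𝕜)) atTop (Bornology.cobounded 𝕜) :=
    tendsto_natCast_atTop_cobounded.comp (tendsto_add_atTop_nat 1)
  have hcov : ⋃ n : ℕ, ((n + 1 : ℕ) : 𝕜) • B = univ := by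
    refine eq_univ_of_forall fun x => ?_
    obtain ⟨n, hn⟩ := (hlim.eventually (hB.absorbent x)).exists
    exact mem_iUnion.2 ⟨n, hn rfl⟩
  obtain ⟨n, hn⟩ := nonempty_interior_of_iUnion_of_closed
    (fun n => hB.isClosed.smul_of_ne_zero (hne n)) hcov
  rw [interior_smul₀ (hne n), smul_set_nonempty] at hn
  obtain ⟨x, hx⟩ := hn
  -- Zero is the midpoint of the interior point `x` of `B` and the point `-x` of `B`.
  have h := hB.convex.combo_interior_self_mem_interior hx
    (hB.balanced.neg_mem_iff.2 (interior_subset hx)) (a := 1 / 2) (b := 1 / 2)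
    (by norm_num) (by norm_num) (by norm_num)
  rw [smul_neg, add_neg_cancel] at h
  exact mem_interior_iff_mem_nhds.1 h

/-- The polar of a continuous functional is a barrel. Applied to evaluations, it shows that
barrel-bounded sets of functions are pointwise bounded. -/
theorem isBarrel_setOf_norm_le_one {𝕜 : Type*} [RCLike 𝕜] {E : Type*} [AddCommGroup E]
    [Module 𝕜 E] [Module ℝ E] [IsScalarTower ℝ 𝕜 E] [TopologicalSpace E] [ContinuousSMul 𝕜 E]
    (χ : E →L[𝕜] 𝕜) : IsBarrel 𝕜 {f | ‖χ f‖ ≤ 1} where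
  isClosed := isClosed_le χ.continuous.norm continuous_const
  convex := by
    have := (convex_closedBall (0 : 𝕜) 1).linear_preimage (χ.toLinearMap.restrictScalars ℝ)
    simpa [preimage] using this
  balanced := by
    rw [balanced_iff_smul_mem]
    intro a ha f hf
    simpa using mul_le_one₀ ha (norm_nonneg _) hf
  absorbent := by
    refine absorbent_nhds_zero <| mem_of_superset
      ((isOpen_lt χ.continuous.norm continuous_const).mem_nhds (by simp : ‖χ 0‖ < 1)) ?_
    exact fun f (hf : ‖χ f‖ < 1) => hf.le

/-- The common part of both cases: `E` stands for a space of continuous functions on `K`, given by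
its evaluation functionals, whose barrels contain balls of the supremum norm. -/
theorem SelectivelySeqPseudocompactSpace.isGelfandPhillips {𝕜 : Type*} [RCLike 𝕜] {K : Type*}
    [TopologicalSpace K] (hK : SelectivelySeqPseudocompactSpace K) {E : Type*} [AddCommGroup E]
    [Module 𝕜 E] [Module ℝ E] [IsScalarTower ℝ 𝕜 E] [TopologicalSpace E]
    [IsTopologicalAddGroup E] [ContinuousSMul 𝕜 E] [LocallyConvexSpace ℝ E] [T2Space E]
    (δ : K → E →L[𝕜] 𝕜) (hδ : ∀ f, Continuous fun x => δ x f)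
    (hbarrel : ∀ B : Set E, IsBarrel 𝕜 B → ∃ ε > 0, ∀ f, (∀ x, ‖δ x f‖ ≤ ε) → f ∈ B) :
    IsGelfandPhillips 𝕜 E := by
  intro A hA B hB
  obtain ⟨ε, hε, hεB⟩ := hbarrel B hB
  have hpt : ∀ x, Bornology.IsBounded (range fun f : A => δ x f) := by
    intro x
    obtain ⟨n, hn⟩ := hA.1 _ (isBarrel_setOf_norm_le_one (δ x))
    refine isBounded_iff_forall_norm_le.2 ⟨n, ?_⟩
    rintro _ ⟨f, rfl⟩
    obtain ⟨g, hg, hgf⟩ := hn f.2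
    simp only [← hgf, map_smul, norm_smul, RCLike.norm_natCast]
    exact mul_le_of_le_one_right n.cast_nonneg hg
  have hrange : ∀ f : A, TotallyBounded (range fun x => δ x f) := by
    intro f
    obtain ⟨C, hC⟩ := hK.exists_norm_le ⟨_, hδ f⟩
    refine (isCompact_closedBall (0 : 𝕜) C).totallyBounded.subset ?_
    rintro _ ⟨x, rfl⟩
    simpa using hC x
  have hseq : ∀ (x : ℕ → K) (l : K), Tendsto x atTop (𝓝 l) →
      TendstoUniformly (fun n (f : A) => δ (x n) f) (fun f => δ l f) atTop := by
    intro x l hx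
    have hnull : Tendsto (fun n => StrongDual.toWeakDual (δ (x n) - δ l)) atTop (𝓝 0) := by
      rw [tendsto_iff_forall_eval_tendsto_topDualPairing]
      intro f
      have := (((hδ f).tendsto l).comp hx).sub_const (δ l f)
      rw [sub_self] at this
      exact this.congr' (.of_forall fun n => rfl)
    have := Metric.tendstoUniformlyOn_iff.1 (hA.2 _ hnull)
    refine Metric.tendstoUniformly_iff.2 fun ε hε => (this ε hε).mono fun n hn f => ?_
    have h := hn f f.2
    rw [dist_zero_left] at h
    rwa [dist_comm, dist_eq_norm]
  obtain ⟨t, ht, htA⟩ := exists_finite_forall_dist_le (F := fun (f : A) x => δ x f) hpt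
    (fun ε hε => hK.finitelyApproximable_univ (fun f : A => hδ f) hrange hseq hε) hε
  refine ⟨(↑) '' t, ht.image _, fun f hf => ?_⟩
  obtain ⟨g, hg, hfg⟩ := htA ⟨f, hf⟩
  refine ⟨g, mem_image_of_mem _ hg, f - g, hεB _ fun x => ?_, add_sub_cancel _ _⟩
  rw [map_sub, ← dist_eq_norm]
  exact hfg x

/-- Evaluation at a point, as a continuous functional on `C_p(X)`. -/
def Cp.evalCLM {X : Type*} (𝕜 : Type*) [TopologicalSpace X] [RCLike 𝕜] (x : X) :
    Cp X 𝕜 →L[𝕜] 𝕜 where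
  toFun f := f x
  map_add' _ _ := rfl
  map_smul' _ _ := rfl
  cont := (continuous_apply x).comp continuous_induced_dom

/-- The inclusion of the Banach space of bounded continuous functions into `C_p(X)`. -/
def Cp.ofBounded (X 𝕜 : Type*) [TopologicalSpace X] [RCLike 𝕜] : (X →ᵇ 𝕜) →L[𝕜] Cp X 𝕜 where
  toFun f := (f.toContinuousMap : C(X, 𝕜))
  map_add' _ _ := rfl
  map_smul' _ _ := rfl
  cont := continuous_induced_rng.2 <| continuous_pi fun x =>
    (BoundedContinuousFunction.evalCLM 𝕜 x).continuous

theorem IsBarrel.preimage {𝕜 : Type*} [RCLike 𝕜] {E F : Type*} [AddCommGroup E] [Module 𝕜 E]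
    [Module ℝ E] [IsScalarTower ℝ 𝕜 E] [TopologicalSpace E] [AddCommGroup F] [Module 𝕜 F]
    [Module ℝ F] [IsScalarTower ℝ 𝕜 F] [TopologicalSpace F] {B : Set F} (hB : IsBarrel 𝕜 B)
    (T : E →L[𝕜] F) : IsBarrel 𝕜 (T ⁻¹' B) where
  isClosed := hB.isClosed.preimage T.continuous
  convex := hB.convex.linear_preimage (T.toLinearMap.restrictScalars ℝ)
  balanced := by
    have h := balanced_iff_smul_mem.1 hB.balanced
    refine balanced_iff_smul_mem.2 fun a ha f hf => ?_
    simpa using h ha hf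
  absorbent f := by
    filter_upwards [hB.absorbent (T f), Bornology.eventually_ne_cobounded 0] with a ha ha0
    rw [singleton_subset_iff, mem_smul_set_iff_inv_smul_mem₀ ha0] at ha ⊢
    simpa using ha

/-- A barrel of the Banach space of bounded continuous functions contains a ball, described
pointwise. -/
theorem IsBarrel.exists_forall_norm_le_imp_mem {𝕜 : Type*} [RCLike 𝕜] {X : Type*}
    [TopologicalSpace X] {B : Set (X →ᵇ 𝕜)} (hB : IsBarrel 𝕜 B) :
    ∃ ε > 0, ∀ f : X →ᵇ 𝕜, (∀ x, ‖f x‖ ≤ ε) → f ∈ B := by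
  obtain ⟨ε, hε, h⟩ := Metric.nhds_basis_closedBall.mem_iff.1 hB.mem_nhds_zero
  exact ⟨ε, hε, fun f hf => h (by simpa using (f.norm_le hε.le).2 hf)⟩

/-- For a selectively sequentially pseudocompact Tychonoff space `K`, the space `C_p(K)` of all
continuous functions with the topology of pointwise convergence and the Banach space `C(K)` of all
continuous (automatically bounded) functions with the supremum norm are Gelfand–Phillips. -/
theorem corollary3p4 {𝕜 : Type*} [RCLike 𝕜] {K : Type*} [TopologicalSpace K] [T35Space K]
    (hK : SelectivelySeqPseudocompactSpace K) :
    IsGelfandPhillips 𝕜 (Cp K 𝕜) ∧ IsGelfandPhillips 𝕜 (K →ᵇ 𝕜) := by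
  refine ⟨hK.isGelfandPhillips (Cp.evalCLM 𝕜)
      (fun f => ContinuousMap.continuous (show C(K, 𝕜) from f)) ?_,
    hK.isGelfandPhillips (BoundedContinuousFunction.evalCLM 𝕜) (fun f => f.continuous)
      fun B hB => hB.exists_forall_norm_le_imp_mem⟩
  intro B hB
  obtain ⟨ε, hε, h⟩ := (hB.preimage (Cp.ofBounded K 𝕜)).exists_forall_norm_le_imp_mem
  exact ⟨ε, hε, fun f hf => h (hK.equivBounded 𝕜 f) hf⟩
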